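/- Fix an integer $N\ge 2$, let $\Lambda=\{N,N+1,\dots\}$ and, for $x\in[0,1]$ and $i\in\Lambda$, put $$u(x,i)=1-\frac{N}{x+i},\qquad P(x,i)=\frac{x+N-1}{(x+i)(x+i-1)} .$$ These data form a random system with complete connections (RSCC) $\{([0,1],\mathcal B_{[0,1]}),\Lambda,u,P\}$: $u$ is a measurable map $[0,1]\times\Lambda\to[0,1]$ and $P(x,A)=\sum_{i\in A}P(x,i)$, $A\subseteq\Lambda$, is a transition probability function from $[0,1]$ to $\Lambda$. Notation. For $x\in[0,1]$ and $\mathbf i=(i_1,\dots,i_r)\in\Lambda^r$ let $x\mathbf i$ be the state reached from $x$ by applying successively $u(\cdot,i_1),\dots,u(\cdot,i_r)$, and let $P_r(x,\cdot)$ be the probability on $\Lambda^r$ that gives $\mathbf i$ the mass $\prod_{m=1}^{r}P(x i_1\cdots i_{m-1},i_m)$. Put $P_r^n(x,A)=P_{n+r-1}(x,\Lambda^{n-1}\times A)$ for $n,r\ge1$, $A\subseteq\Lambda^r$. Let $Q(x,B)=\sum_{i\in\Lambda:\,u(x,i)\in B}P(x,i)$ be the transition function of the associated Markov chain on $[0,1]$,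 $Q^n$ its $n$-step transition function, and $Uf(x)=\sum_{i\ge N}P(x,i)f(u(x,i))$ its transition operator. Let $L([0,1])$ be the space of complex-valued Lipschitz functions on $[0,1]$ with the norm $\|f\|_L=\sup_x|f(x)|+\sup_{x\ne y}\frac{|f(x)-f(y)|}{|x-y|}$. Then the following hold. 1. The RSCC is with contraction: with $$r_j=\sup_{x\neq y}\sum_{\mathbf i\in\Lambda^j}P_j(x,\{\mathbf i\})\frac{|x\mathbf i-y\mathbf i|}{|x-y|},\qquad R_j=\sup_{A\subseteq\Lambda^j}\ \sup_{x\ne y}\frac{|P_j(x,A)-P_j(y,A)|}{|x-y|},$$ one has $r_1<\infty$, $R_1<\infty$, and $r_j<1$ for some $j\ge1$. 2. Let $x^*=\frac{\sqrt{N^2+4}-N}{2}$. Then $x^*\in[0,1]$ and, for every $x\in[0,1]$, the distance from $x^*$ to the support of $Q^n(x,\cdot)$ tends to $0$ as $n\to\infty$. 3. The associated Markov chain is regular: $U$ is a bounded operator on $L([0,1])$ and $U^n$ converges, in the operator norm of $L([0,1])$, to a bounded linear operator with one-dimensional range. 4. The RSCC is uniformly ergodic: for every $r\ge1$ there is a probability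 $P_r^\infty$ on $\Lambda^r$ such that $$\lim_{n\to\infty}\ \sup_{x\in[0,1],\ r\ge1,\ A\subseteq\Lambda^r}\bigl|P_r^n(x,A)-P_r^\infty(A)\bigr|=0 .$$ 5. There is a unique probability measure $Q^\infty$ on $[0,1]$ that is stationary for $Q$, and there are constants $k>0$ and $0<q<1$ such that, for all $n\ge1$ and $f\in L([0,1])$, $$\Bigl\|U^nf-\int_{[0,1]}f\,dQ^\infty\Bigr\|_L\le k\,q^n\,\|f\|_L .$$ -/

import Mathlib

open MeasureTheory ProbabilityTheory Filter Topology
open scoped ENNReal NNReal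

noncomputable section

/-- A random system with complete connections `{(W, 𝓦), (X, 𝓧), u, P}`: measurable spaces `W` and
`X`, a measurable map `u : W × X → W` and a transition probability function `P` from `W` to `X`. -/
structure RSCC (W X : Type*) [MeasurableSpace W] [MeasurableSpace X] where
  /-- The transition map, `u w x = wx`. -/
  u : W → X → W
  measurable_u : Measurable (Function.uncurry u)
  /-- The transition probability function. -/
  P : Kernel W X
  isMarkovKernel_P : IsMarkovKernel P

namespace RSCC

/-- The state `w x₁ x₂ ⋯ x_r` reached from `w` along the word `(x₁, …, x_r)`. -/
def path {W X : Type*} [MeasurableSpace W] [MeasurableSpace X] (S : RSCC W X) :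
    (r : ℕ) → W → (Fin r → X) → W
  | 0, w, _ => w
  | r + 1, w, x => S.path r (S.u w (x 0)) (Fin.tail x)

/-- The transition probability function `P_r` from `W` to `X^r`:
`P_r(w, A) = ∫ P(w, dx₁) ∫ P(wx₁, dx₂) ⋯ ∫ P(wx₁⋯x_{r-1}, dx_r) 1_A(x₁, …, x_r)`. -/
def wordKernel {W X : Type*} [MeasurableSpace W] [MeasurableSpace X] (S : RSCC W X) :
    (r : ℕ) → Kernel W (Fin r → X)
  | 0 => Kernel.const W (Measure.dirac Fin.elim0)
  | r + 1 =>
    (S.P ⊗ₖ ((S.wordKernel r).comap (Function.uncurry S.u) S.measurable_u)).map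
      (fun p : X × (Fin r → X) => (Fin.cons p.1 p.2 : Fin (r + 1) → X))

instance isMarkovKernel_wordKernel {W X : Type*} [MeasurableSpace W] [MeasurableSpace X]
    (S : RSCC W X) (r : ℕ) : IsMarkovKernel (S.wordKernel r) := by
  induction r with
  | zero => unfold wordKernel; infer_instance
  | succ r ih =>
    have := S.isMarkovKernel_P
    have hm : Measurable
        (fun p : X × (Fin r → X) => (Fin.cons p.1 p.2 : Fin (r + 1) → X)) := by
      refine measurable_pi_lambda _ fun i => ?_
      refine Fin.cases ?_ (fun j => ?_) i
      · simpa using measurable_fst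
      · simpa [Function.comp_def] using (measurable_pi_apply j).comp measurable_snd
    unfold wordKernel
    exact Kernel.IsMarkovKernel.map _ hm

/-- `P_r^n(w, A) = P_{n+r-1}(w, X^{n-1} × A)` for `n ≥ 1`: the law of the letters with indices
`n, n + 1, …, n + r - 1` when the system starts in `w`. -/
def shiftedKernel {W X : Type*} [MeasurableSpace W] [MeasurableSpace X] (S : RSCC W X)
    (n r : ℕ) : Kernel W (Fin r → X) :=
  (S.wordKernel ((n - 1) + r)).map (fun x i => x (Fin.natAdd (n - 1) i))

/-- The transition probability function of the associated Markov chain: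
`Q(w, B) = P(w, {x | u w x ∈ B})`. Its `n`-step version `Q^n` is the power `S.Q ^ n` in the monoid
of kernels under composition. -/
def Q {W X : Type*} [MeasurableSpace W] [MeasurableSpace X] (S : RSCC W X) : Kernel W W :=
  (Kernel.id ×ₖ S.P).map (Function.uncurry S.u)

/-- The transition operator `U f (w) = ∫ P(w, dx) f(wx)` of the associated Markov chain. -/
def U {W X : Type*} [MeasurableSpace W] [MeasurableSpace X] (S : RSCC W X) (f : W → ℂ) : W → ℂ :=
  fun w => ∫ x, f (S.u w x) ∂(S.P w)

/-- `r_j = sup_{w' ≠ w''} ∫ P_j(w', dx) d(w'x, w''x) / d(w', w'')`, where `x` ranges over `X^j`. -/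
def rCoeff {W X : Type*} [MetricSpace W] [MeasurableSpace W] [MeasurableSpace X]
    (S : RSCC W X) (j : ℕ) : ℝ≥0∞ :=
  ⨆ (w' : W) (w'' : W) (_ : w' ≠ w''),
    (∫⁻ x, edist (S.path j w' x) (S.path j w'' x) ∂(S.wordKernel j w')) / edist w' w''

/-- `R_j = sup_A sup_{w' ≠ w''} |P_j(w', A) - P_j(w'', A)| / d(w', w'')`, where `A` ranges over the
measurable subsets of `X^j`. -/
def RCoeff {W X : Type*} [MetricSpace W] [MeasurableSpace W] [MeasurableSpace X]
    (S : RSCC W X) (j : ℕ) : ℝ≥0∞ :=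
  ⨆ (A : Set (Fin j → X)) (_ : MeasurableSet A) (w' : W) (w'' : W) (_ : w' ≠ w''),
    ENNReal.ofReal |(S.wordKernel j w').real A - (S.wordKernel j w'').real A| / edist w' w''

/-- An RSCC with contraction: `r_1 < ∞`, `R_1 < ∞`, and `r_j < 1` for some `j ≥ 1`. -/
def IsWithContraction {W X : Type*} [MetricSpace W] [MeasurableSpace W] [MeasurableSpace X]
    (S : RSCC W X) : Prop :=
  S.rCoeff 1 < ∞ ∧ S.RCoeff 1 < ∞ ∧ ∃ j : ℕ, 1 ≤ j ∧ S.rCoeff j < 1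

/-- An RSCC is uniformly ergodic if for every `r ≥ 1` there is a probability measure `P_r^∞` on
`X^r` such that `P_r^n(w, A) → P_r^∞(A)` as `n → ∞`, uniformly with respect to `w ∈ W`, `r ≥ 1` and
`A` measurable in `X^r`. -/
def IsUniformlyErgodic {W X : Type*} [MeasurableSpace W] [MeasurableSpace X]
    (S : RSCC W X) : Prop :=
  ∃ Pinf : (r : ℕ) → Measure (Fin r → X), (∀ r, 1 ≤ r → IsProbabilityMeasure (Pinf r)) ∧
    ∀ ε : ℝ, 0 < ε → ∃ n₀ : ℕ, ∀ n : ℕ, n₀ ≤ n → ∀ (w : W) (r : ℕ), 1 ≤ r →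
      ∀ A : Set (Fin r → X), MeasurableSet A →
        |(S.shiftedKernel n r w).real A - (Pinf r).real A| ≤ ε

end RSCC

/-- The norm `‖f‖_L = sup |f| + sup_{w' ≠ w''} |f(w') - f(w'')| / d(w', w'')`, with value `∞` if `f`
is not a bounded Lipschitz function. -/
def lipNorm {W : Type*} [MetricSpace W] (f : W → ℂ) : ℝ≥0∞ :=
  (⨆ w : W, ‖f w‖ₑ) +
    ⨆ (w' : W) (w'' : W) (_ : w' ≠ w''), ‖f w' - f w''‖ₑ / edist w' w''

theorem lipNorm_add_le {W : Type*} [MetricSpace W] (f g : W → ℂ) :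
    lipNorm (f + g) ≤ lipNorm f + lipNorm g := by
  unfold lipNorm
  rw [add_add_add_comm]
  refine add_le_add (iSup_le fun w => (enorm_add_le _ _).trans ?_)
    (iSup_le fun a => iSup_le fun b => iSup_le fun hab => ?_)
  · exact add_le_add (le_iSup (fun w => ‖f w‖ₑ) w) (le_iSup (fun w => ‖g w‖ₑ) w)
  · have h1 : ‖(f + g) a - (f + g) b‖ₑ ≤ ‖f a - f b‖ₑ + ‖g a - g b‖ₑ := by
      have : (f + g) a - (f + g) b = (f a - f b) + (g a - g b) := by
        simp only [Pi.add_apply]; ring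
      rw [this]; exact enorm_add_le _ _
    refine (ENNReal.div_le_div_right h1 _).trans ?_
    rw [ENNReal.add_div]
    exact add_le_add
      (le_iSup₂_of_le a b (le_iSup (fun _ : a ≠ b => ‖f a - f b‖ₑ / edist a b) hab))
      (le_iSup₂_of_le a b (le_iSup (fun _ : a ≠ b => ‖g a - g b‖ₑ / edist a b) hab))

theorem lipNorm_smul_le {W : Type*} [MetricSpace W] (c : ℂ) (f : W → ℂ) :
    lipNorm (c • f) ≤ ‖c‖ₑ * lipNorm f := by
  unfold lipNorm
  rw [mul_add]
  refine add_le_add (iSup_le fun w => ?_)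
    (iSup_le fun a => iSup_le fun b => iSup_le fun hab => ?_)
  · rw [Pi.smul_apply, enorm_smul]
    gcongr
    exact le_iSup (fun w => ‖f w‖ₑ) w
  · rw [Pi.smul_apply, Pi.smul_apply, ← smul_sub, enorm_smul, mul_div_assoc]
    gcongr
    exact le_iSup₂_of_le a b (le_iSup (fun _ : a ≠ b => ‖f a - f b‖ₑ / edist a b) hab)

/-- The space `L(W)` of all bounded complex-valued Lipschitz functions on `W`. -/
def lipSpace (W : Type*) [MetricSpace W] : Submodule ℂ (W → ℂ) where
  carrier := {f | lipNorm f < ∞}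
  zero_mem' := by simp [lipNorm]
  add_mem' := fun {f g} hf hg =>
    (lipNorm_add_le f g).trans_lt (ENNReal.add_lt_top.2 ⟨hf, hg⟩)
  smul_mem' := fun c f hf =>
    (lipNorm_smul_le c f).trans_lt (ENNReal.mul_lt_top enorm_lt_top hf)

/-- The Markov chain associated with an RSCC is regular: its transition operator `U` is a bounded
operator on `L(W)`, and the powers `U^n` converge in the operator norm of `L(W)` to a bounded linear
operator `U^∞` on `L(W)` with one-dimensional range. -/
def RSCC.IsRegular {W X : Type*} [MetricSpace W] [MeasurableSpace W] [MeasurableSpace X]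
    (S : RSCC W X) : Prop :=
  (∃ C : ℝ≥0, ∀ f ∈ lipSpace W, lipNorm (S.U f) ≤ C * lipNorm f) ∧
  ∃ Uinf : lipSpace W →ₗ[ℂ] lipSpace W,
    (∃ C : ℝ≥0, ∀ f : lipSpace W, lipNorm (Uinf f : W → ℂ) ≤ C * lipNorm (f : W → ℂ)) ∧
    Module.finrank ℂ (LinearMap.range Uinf) = 1 ∧
    Tendsto (fun n : ℕ => ⨆ (f : lipSpace W) (_ : lipNorm (f : W → ℂ) ≤ 1),
      lipNorm (S.U^[n] f - (Uinf f : W → ℂ))) atTop (𝓝 0)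

/-- `u(x, i) = 1 - N / (x + i)`. -/
def renyiU (N : ℕ) (x : ℝ) (i : ℕ) : ℝ := 1 - (N : ℝ) / (x + i)

/-- `P(x, i) = (x + N - 1) / ((x + i) (x + i - 1))`. -/
def renyiP (N : ℕ) (x : ℝ) (i : ℕ) : ℝ := (x + N - 1) / ((x + i) * (x + i - 1))

theorem renyiU_mem {N : ℕ} (hN : 2 ≤ N) (x : Set.Icc (0 : ℝ) 1) (i : Set.Ici N) :
    renyiU N x i ∈ Set.Icc (0 : ℝ) 1 := by
  have h1 : (2 : ℝ) ≤ N := by exact_mod_cast hN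
  have h2 : (N : ℝ) ≤ (i : ℕ) := by exact_mod_cast i.2
  have h3 := x.2.1
  have h4 : (0 : ℝ) < x + (i : ℕ) := by linarith
  refine ⟨?_, ?_⟩
  · rw [renyiU, sub_nonneg, div_le_one h4]; linarith
  · rw [renyiU]
    have : 0 ≤ (N : ℝ) / (x + (i : ℕ)) := by positivity
    linarith

theorem renyiP_nonneg {N : ℕ} (hN : 2 ≤ N) (x : Set.Icc (0 : ℝ) 1) (i : Set.Ici N) :
    0 ≤ renyiP N x i := by
  have h1 : (2 : ℝ) ≤ N := by exact_mod_cast hN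
  have h2 : (N : ℝ) ≤ (i : ℕ) := by exact_mod_cast i.2
  have h3 := x.2.1
  exact div_nonneg (by linarith) (mul_nonneg (by linarith) (by linarith))

theorem hasSum_renyiP {N : ℕ} (hN : 2 ≤ N) (x : Set.Icc (0 : ℝ) 1) :
    HasSum (fun i : Set.Ici N => renyiP N x i) 1 := by
  have h1 : (2 : ℝ) ≤ N := by exact_mod_cast hN
  have h3 := x.2.1
  let e : ℕ ≃ Set.Ici N :=
    { toFun := fun k => ⟨N + k, Nat.le_add_right N k⟩
      invFun := fun i => (i : ℕ) - N
      left_inv := fun k => by simp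
      right_inv := fun i => Subtype.ext (Nat.add_sub_cancel' i.2) }
  rw [← e.hasSum_iff]
  have hc : (0 : ℝ) < x + N - 1 := by linarith
  have key : ∀ n : ℕ, ∑ k ∈ Finset.range n, ((fun i : Set.Ici N => renyiP N x i) ∘ e) k
      = 1 - (x + N - 1) / (x + N - 1 + n) := by
    intro n
    induction n with
    | zero => simp [div_self hc.ne']
    | succ n ih =>
      rw [Finset.sum_range_succ, ih]
      simp only [Function.comp_apply, e, Equiv.coe_fn_mk, renyiP]
      push_cast
      have hn : (0 : ℝ) ≤ n := n.cast_nonneg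
      have a1 : (x : ℝ) + N - 1 + n ≠ 0 := by linarith
      have a2 : (x : ℝ) + N - 1 + (n + 1) ≠ 0 := by linarith
      have a3 : (x : ℝ) + (N + n) ≠ 0 := by linarith
      have a4 : (x : ℝ) + (N + n) - 1 ≠ 0 := by linarith
      field_simp
      ring
  refine (hasSum_iff_tendsto_nat_of_nonneg (fun k => renyiP_nonneg hN x (e k)) _).2 ?_
  change Tendsto (fun n : ℕ => ∑ k ∈ Finset.range n,
    ((fun i : Set.Ici N => renyiP N x i) ∘ e) k) atTop (𝓝 1)
  simp_rw [key]
  have : Tendsto (fun n : ℕ => ((x : ℝ) + N - 1) / (x + N - 1 + n)) atTop (𝓝 0) :=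
    tendsto_const_nhds.div_atTop
      (tendsto_atTop_add_const_left _ _ tendsto_natCast_atTop_atTop)
  simpa using tendsto_const_nhds.sub this

/-- The RSCC `{([0, 1], 𝓑), Λ, u, P}` with `Λ = {N, N + 1, …}`, `u(x, i) = 1 - N / (x + i)` and
`P(x, {i}) = (x + N - 1) / ((x + i) (x + i - 1))`. -/
def renyiRSCC (N : ℕ) (hN : 2 ≤ N) : RSCC (Set.Icc (0 : ℝ) 1) (Set.Ici N) where
  u x i := ⟨renyiU N x i, renyiU_mem hN x i⟩
  measurable_u := by
    refine measurable_from_prod_countable_left fun i => ?_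
    refine Measurable.subtype_mk ?_
    unfold renyiU
    fun_prop
  P :=
    { toFun := fun x =>
        Measure.sum fun i : Set.Ici N => ENNReal.ofReal (renyiP N x i) • Measure.dirac i
      measurable' := by
        refine Measure.measurable_of_measurable_coe _ fun s hs => ?_
        simp only [Measure.sum_apply _ hs, Measure.smul_apply, smul_eq_mul]
        refine Measurable.tsum fun i => Measurable.mul_const ?_ _
        unfold renyiP
        fun_prop }
  isMarkovKernel_P := ⟨fun x => ⟨by
    have h := hasSum_renyiP hN x
    simp only [Kernel.coe_mk, Measure.sum_apply _ MeasurableSet.univ, Measure.smul_apply,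
      measure_univ, smul_eq_mul, mul_one]
    rw [← ENNReal.ofReal_tsum_of_nonneg (renyiP_nonneg hN x) h.summable, h.tsum_eq,
      ENNReal.ofReal_one]⟩⟩

end

/-! Everything rests on an explicit contraction: `U` shrinks the Lipschitz seminorm by 7/8
(`norm_U_sub_le`). Two effects compete in `norm_integral_sub_integral_le`: each branch contracts by
1/N, while the change of the weights costs total variation times the oscillation of the function.
The weights move by at most 1 - 1/N + 1/N² per unit distance, and centring a function at the
midpoint halves its oscillation, so the total stays below 1 even for N = 2.

Hence the oscillation of `U^[n] f` decays geometrically. Compactness then gives a stationary measure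
(`exists_invariant`), integration against it gives convergence at rate (7/8)^n, and uniqueness and
regularity follow. For uniform ergodicity, z ↦ P_r(z, A) is Lipschitz with constant 2 for all r and
A (`norm_wordKernel_sub_le`), so the same rate applies uniformly.

The statement about supports is separate: x* is the fixed point of the branch i = N + 1, and
iterates of that branch are atoms of Q^n(x, ·). -/

/-! ### Lipschitz estimates for the branches and the weights. -/

theorem abs_renyiU_sub_le {N i : ℕ} (hN : 2 ≤ N) (hi : N ≤ i) {x y : ℝ} (hx : 0 ≤ x)
    (hy : 0 ≤ y) : |renyiU N x i - renyiU N y i| ≤ |x - y| / N := by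
  have h1 : (2 : ℝ) ≤ N := by exact_mod_cast hN
  have h2 : (N : ℝ) ≤ i := by exact_mod_cast hi
  have h3 : (0 : ℝ) < x + i := by linarith
  have h4 : (0 : ℝ) < y + i := by linarith
  have h0 : (0 : ℝ) < N := by linarith
  have : renyiU N x i - renyiU N y i = N * (x - y) / ((x + i) * (y + i)) := by
    unfold renyiU; field_simp; ring
  rw [this, abs_div, abs_mul, abs_of_pos h0, abs_of_pos (mul_pos h3 h4),
    div_le_div_iff₀ (mul_pos h3 h4) h0]
  have : (N : ℝ) * N ≤ (x + i) * (y + i) := by gcongr <;> linarith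
  nlinarith [abs_nonneg (x - y)]

theorem renyiP_sub_eq {N i : ℕ} (hN : 2 ≤ N) (hi : N ≤ i) {x y : ℝ} (hx : 0 ≤ x) (hy : 0 ≤ y) :
    renyiP N x i - renyiP N y i =
      (x - y) * (((i : ℝ) - N) * (i - N + 1) - (x + N - 1) * (y + N - 1)) /
        ((x + i) * (x + i - 1) * ((y + i) * (y + i - 1))) := by
  have h1 : (2 : ℝ) ≤ N := by exact_mod_cast hN
  have h2 : (N : ℝ) ≤ i := by exact_mod_cast hi
  have h3 : x + i ≠ 0 := by linarith
  have h4 : x + i - 1 ≠ 0 := by linarith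
  have h5 : y + i ≠ 0 := by linarith
  have h6 : y + i - 1 ≠ 0 := by linarith
  unfold renyiP
  field_simp
  ring

/-- The majorant P(0, i) does not depend on x and y and sums to 1, so the weights vary by at most |x
- y| in ℓ¹. -/
theorem abs_renyiP_sub_le {N i : ℕ} (hN : 2 ≤ N) (hi : N ≤ i) {x y : ℝ} (hx : 0 ≤ x)
    (hy : 0 ≤ y) : |renyiP N x i - renyiP N y i| ≤ renyiP N 0 i * |x - y| := by
  have h1 : (2 : ℝ) ≤ N := by exact_mod_cast hN
  have h2 : (N : ℝ) ≤ i := by exact_mod_cast hi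
  rw [renyiP_sub_eq hN hi hx hy]
  have p1 : (0 : ℝ) < x + i := by linarith
  have p2 : (0 : ℝ) < x + i - 1 := by linarith
  have p3 : (0 : ℝ) < y + i := by linarith
  have p4 : (0 : ℝ) < y + i - 1 := by linarith
  have p5 : (0 : ℝ) < i := by linarith
  have p6 : (0 : ℝ) < (i : ℝ) - 1 := by linarith
  have hm : |((i : ℝ) - N) * (i - N + 1) - (x + N - 1) * (y + N - 1)| ≤
      (x + i) * (y + i - 1) := by
    have e1 : ((i : ℝ) - N) * (i - N + 1) ≤ (y + i - 1) * (x + i) :=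
      mul_le_mul (by linarith) (by linarith) (by linarith) p4.le
    have e2 : (x + N - 1) * (y + N - 1) ≤ (x + i) * (y + i - 1) :=
      mul_le_mul (by linarith) (by linarith) (by linarith) p1.le
    have e3 : 0 ≤ ((i : ℝ) - N) * (i - N + 1) := mul_nonneg (by linarith) (by linarith)
    have e4 : 0 ≤ (x + N - 1) * (y + N - 1) := mul_nonneg (by linarith) (by linarith)
    rw [abs_le]
    constructor <;> linarith
  rw [abs_div, abs_mul, abs_of_pos (mul_pos (mul_pos p1 p2) (mul_pos p3 p4))]
  calc _ ≤ |x - y| * ((x + i) * (y + i - 1)) / ((x + i) * (x + i - 1) * ((y + i) * (y + i - 1))) := by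
        gcongr
    _ = |x - y| / ((x + i - 1) * (y + i)) := by field_simp
    _ ≤ |x - y| / ((i - 1) * i) := by gcongr <;> linarith
    _ ≤ (N - 1) / (i * (i - 1)) * |x - y| := by
        rw [div_mul_eq_mul_div, mul_comm ((i : ℝ) - 1)]
        gcongr
        nlinarith [abs_nonneg (x - y)]
    _ = _ := by unfold renyiP; simp

/-- At i = N this improves the general factor P(0, N) = 1/N to 1/N². Without the gain the
contraction factor of `U` would be 1/N + 1/2, which is 1 when N = 2. -/
theorem abs_renyiP_self_sub_le {N : ℕ} (hN : 2 ≤ N) {x y : ℝ} (hx : 0 ≤ x) (hy : 0 ≤ y) :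
    |renyiP N x N - renyiP N y N| ≤ 1 / N ^ 2 * |x - y| := by
  have h1 : (2 : ℝ) ≤ N := by exact_mod_cast hN
  have h0 : (0 : ℝ) < N := by linarith
  have p1 : (0 : ℝ) < x + N := by linarith
  have p2 : (0 : ℝ) < x + N - 1 := by linarith
  have p3 : (0 : ℝ) < y + N := by linarith
  have p4 : (0 : ℝ) < y + N - 1 := by linarith
  have : renyiP N x N - renyiP N y N = (y - x) / ((x + N) * (y + N)) := by
    unfold renyiP; field_simp; ring
  rw [this, abs_div, abs_of_pos (mul_pos p1 p3), abs_sub_comm, div_mul_eq_mul_div, one_mul, sq]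
  gcongr <;> linarith

theorem renyiP_zero_self {N : ℕ} (hN : 2 ≤ N) : renyiP N 0 N = 1 / N := by
  have h1 : (2 : ℝ) ≤ N := by exact_mod_cast hN
  have h0 : (N : ℝ) ≠ 0 := by linarith
  have h2 : (N : ℝ) - 1 ≠ 0 := by linarith
  unfold renyiP
  simp only [zero_add]
  field_simp

/-! ### Contraction of the transition operator. -/

theorem renyiRSCC_P_apply {N : ℕ} (hN : 2 ≤ N) (x : Set.Icc (0 : ℝ) 1) :
    (renyiRSCC N hN).P x =
      Measure.sum fun i : Set.Ici N => ENNReal.ofReal (renyiP N x i) • Measure.dirac i := rfl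

instance {N : ℕ} (hN : 2 ≤ N) : IsMarkovKernel (renyiRSCC N hN).P :=
  (renyiRSCC N hN).isMarkovKernel_P

theorem integrable_of_norm_sub_le {α : Type*} [MeasurableSpace α] {μ : Measure α}
    [IsFiniteMeasure μ] {f : α → ℂ} (hf : AEStronglyMeasurable f μ) {c : ℂ} {M : ℝ}
    (h : ∀ a, ‖f a - c‖ ≤ M) : Integrable f μ :=
  .of_bound hf (M + ‖c‖) (.of_forall fun a => by
    linarith [norm_sub_norm_le (f a) c, h a])

theorem hasSum_renyiP_mul {N : ℕ} (hN : 2 ≤ N) (x : Set.Icc (0 : ℝ) 1) {g : Set.Ici N → ℂ}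
    {c : ℂ} {M : ℝ} (hg : ∀ i, ‖g i - c‖ ≤ M) :
    HasSum (fun i : Set.Ici N => (renyiP N x i : ℂ) * g i) (∫ i, g i ∂(renyiRSCC N hN).P x) := by
  have hi : Integrable g ((renyiRSCC N hN).P x) :=
    integrable_of_norm_sub_le (measurable_of_countable g).aestronglyMeasurable hg
  rw [renyiRSCC_P_apply] at hi ⊢
  have h := hasSum_integral_measure hi
  simp only [integral_smul_measure, integral_dirac, Complex.real_smul,
    ENNReal.toReal_ofReal (renyiP_nonneg hN x _)] at h
  exact h

/-- Two-sided estimate combining the contraction of the branches with the total variation of the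
transition probabilities. -/
theorem norm_integral_sub_integral_le {N : ℕ} (hN : 2 ≤ N)
    {g : Set.Ici N → Set.Icc (0 : ℝ) 1 → ℂ} {c : ℂ} {L M : ℝ} (hL : 0 ≤ L)
    (hgL : ∀ i x y, ‖g i x - g i y‖ ≤ L * dist x y) (hgM : ∀ i x, ‖g i x - c‖ ≤ M)
    (x y : Set.Icc (0 : ℝ) 1) :
    ‖(∫ i, g i ((renyiRSCC N hN).u x i) ∂(renyiRSCC N hN).P x) -
        ∫ i, g i ((renyiRSCC N hN).u y i) ∂(renyiRSCC N hN).P y‖ ≤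
      (L / N + (1 - 1 / N + 1 / N ^ 2) * M) * dist x y := by
  have h1 : (2 : ℝ) ≤ N := by exact_mod_cast hN
  have sx := hasSum_renyiP_mul hN x (g := fun i => g i ((renyiRSCC N hN).u x i)) (fun i => hgM i _)
  have sy := hasSum_renyiP_mul hN y (g := fun i => g i ((renyiRSCC N hN).u y i)) (fun i => hgM i _)
  -- The weights at x and at y both sum to 1, so subtracting c is free and only the oscillation of g
  -- about c is charged.
  have s0 : HasSum (fun i : Set.Ici N => ((renyiP N x i - renyiP N y i : ℝ) : ℂ) * c) 0 := by
    have := (Complex.hasSum_ofReal.2 ((hasSum_renyiP hN x).sub (hasSum_renyiP hN y))).mul_right c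
    simpa using this
  have s := (sx.sub sy).sub s0
  rw [sub_zero] at s
  set d := dist x y with hd
  have hd' : d = |(x : ℝ) - y| := by rw [hd, Subtype.dist_eq, Real.dist_eq]
  have d0 : 0 ≤ d := dist_nonneg
  let o : Set.Ici N := ⟨N, Set.self_mem_Ici⟩
  -- The second majorant is P(0, i) with its term 1/N at i = N lowered to 1/N², which gives the sum
  -- 1 - 1/N + 1/N².
  have b1 := ((hasSum_renyiP hN x).mul_right (L / N * d)).add
    (((hasSum_renyiP hN 0).sub (hasSum_ite_eq o (1 / (N : ℝ) - 1 / N ^ 2))).mul_right (d * M))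
  refine (s.norm_le_of_bounded b1 fun i => ?_).trans_eq (by ring)
  have hu : dist ((renyiRSCC N hN).u x i) ((renyiRSCC N hN).u y i) ≤ d / N := by
    rw [Subtype.dist_eq, Real.dist_eq, hd']
    exact abs_renyiU_sub_le hN i.2 x.2.1 y.2.1
  have hP : |renyiP N x i - renyiP N y i| ≤
      (renyiP N (0 : Set.Icc (0 : ℝ) 1) i - if i = o then (1 / (N : ℝ) - 1 / N ^ 2) else 0) * d := by
    rw [hd']
    split_ifs with hio
    · subst hio
      have := abs_renyiP_self_sub_le hN x.2.1 y.2.1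
      simp only [Set.Icc.coe_zero, o, renyiP_zero_self hN]
      linarith
    · simpa using abs_renyiP_sub_le hN i.2 x.2.1 y.2.1
  have e : (renyiP N x i : ℂ) * g i ((renyiRSCC N hN).u x i) -
        (renyiP N y i : ℂ) * g i ((renyiRSCC N hN).u y i) -
        ((renyiP N x i - renyiP N y i : ℝ) : ℂ) * c =
      (renyiP N x i : ℂ) * (g i ((renyiRSCC N hN).u x i) - g i ((renyiRSCC N hN).u y i)) +
        ((renyiP N x i - renyiP N y i : ℝ) : ℂ) * (g i ((renyiRSCC N hN).u y i) - c) := by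
    push_cast; ring
  rw [e]
  refine (norm_add_le _ _).trans (add_le_add ?_ ?_)
  · rw [norm_mul, Complex.norm_real, Real.norm_of_nonneg (renyiP_nonneg hN x i)]
    refine mul_le_mul_of_nonneg_left ?_ (renyiP_nonneg hN x i)
    calc _ ≤ L * (d / N) := (hgL i _ _).trans (by gcongr)
      _ = _ := by ring
  · rw [norm_mul, Complex.norm_real, Real.norm_eq_abs, ← mul_assoc]
    exact mul_le_mul hP (hgM i _) (norm_nonneg _) ((abs_nonneg _).trans hP)

/-- No point of [0, 1] is farther than 1/2 from the midpoint; this supplies c and M = L/2 for the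
contraction. -/
theorem norm_sub_half_le {f : Set.Icc (0 : ℝ) 1 → ℂ} {L : ℝ} (hL : 0 ≤ L)
    (hf : ∀ x y, ‖f x - f y‖ ≤ L * dist x y) (x : Set.Icc (0 : ℝ) 1) :
    ‖f x - f ⟨1 / 2, by norm_num, by norm_num⟩‖ ≤ L / 2 := by
  have hd : dist x ⟨1 / 2, by norm_num, by norm_num⟩ ≤ 1 / 2 := by
    rw [Subtype.dist_eq, Real.dist_eq, abs_le]
    constructor <;> linarith [x.2.1, x.2.2]
  calc _ ≤ L * (1 / 2) := (hf _ _).trans (mul_le_mul_of_nonneg_left hd hL)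
    _ = L / 2 := by ring

theorem dist_Icc_le_one (x y : Set.Icc (0 : ℝ) 1) : dist x y ≤ 1 := by
  rw [Subtype.dist_eq, Real.dist_eq, abs_le]
  constructor <;> linarith [x.2.1, x.2.2, y.2.1, y.2.2]

theorem norm_U_sub_le {N : ℕ} (hN : 2 ≤ N) {f : Set.Icc (0 : ℝ) 1 → ℂ} {L : ℝ} (hL : 0 ≤ L)
    (hf : ∀ x y, ‖f x - f y‖ ≤ L * dist x y) (x y : Set.Icc (0 : ℝ) 1) :
    ‖(renyiRSCC N hN).U f x - (renyiRSCC N hN).U f y‖ ≤ 7 / 8 * L * dist x y := by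
  refine (norm_integral_sub_integral_le hN (g := fun _ => f) hL
    (fun _ => hf) (fun _ => norm_sub_half_le hL hf) x y).trans ?_
  refine mul_le_mul_of_nonneg_right ?_ dist_nonneg
  have h1 : (2 : ℝ) ≤ N := by exact_mod_cast hN
  have h2 : 1 / (N : ℝ) ≤ 1 / 2 := by gcongr
  have h3 : 0 ≤ 1 / (N : ℝ) := by positivity
  have h4 : 1 / (N : ℝ) ^ 2 = (1 / N) ^ 2 := by ring
  have h5 : L / N = L * (1 / N) := by ring
  rw [h4, h5]
  -- With t = 1/N the left side is (1 + t + t²)/2, increasing in t, and equal to 7/8 at t = 1/2.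
  have : 1 / (N : ℝ) + (1 - 1 / N + (1 / N) ^ 2) / 2 ≤ 7 / 8 := by nlinarith
  nlinarith

theorem norm_U_iterate_sub_le {N : ℕ} (hN : 2 ≤ N) {f : Set.Icc (0 : ℝ) 1 → ℂ} {L : ℝ}
    (hL : 0 ≤ L) (hf : ∀ x y, ‖f x - f y‖ ≤ L * dist x y) (n : ℕ) (x y : Set.Icc (0 : ℝ) 1) :
    ‖(renyiRSCC N hN).U^[n] f x - (renyiRSCC N hN).U^[n] f y‖ ≤ (7 / 8) ^ n * L * dist x y := by
  induction n generalizing x y with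
  | zero => simpa using hf x y
  | succ n ih =>
    rw [Function.iterate_succ']
    refine (norm_U_sub_le hN (by positivity) ih x y).trans_eq (by ring)

theorem norm_U_le {N : ℕ} (hN : 2 ≤ N) {f : Set.Icc (0 : ℝ) 1 → ℂ} {M : ℝ}
    (hf : ∀ x, ‖f x‖ ≤ M) (x : Set.Icc (0 : ℝ) 1) : ‖(renyiRSCC N hN).U f x‖ ≤ M := by
  refine (norm_integral_le_of_norm_le_const (.of_forall fun i => hf _)).trans_eq ?_
  simp

theorem continuous_of_norm_sub_le {f : Set.Icc (0 : ℝ) 1 → ℂ} {L : ℝ} (hL : 0 ≤ L)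
    (hf : ∀ x y, ‖f x - f y‖ ≤ L * dist x y) : Continuous f :=
  (LipschitzWith.of_dist_le_mul (K := ⟨L, hL⟩) fun x y => by
    rw [dist_eq_norm]; exact hf x y).continuous

/-! ### Word kernels and the associated chain expressed through `U`. -/

namespace RSCC

variable {W X : Type*} [MeasurableSpace W] [MeasurableSpace X]

theorem measurable_fin_cons (r : ℕ) :
    Measurable (fun p : X × (Fin r → X) => (Fin.cons p.1 p.2 : Fin (r + 1) → X)) := by
  refine measurable_pi_lambda _ fun i => ?_
  refine Fin.cases ?_ (fun j => ?_) i
  · simpa using measurable_fst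
  · simpa [Function.comp_def] using (measurable_pi_apply j).comp measurable_snd

theorem wordKernel_succ_apply (S : RSCC W X) (r : ℕ) (w : W) {A : Set (Fin (r + 1) → X)}
    (hA : MeasurableSet A) :
    S.wordKernel (r + 1) w A =
      ∫⁻ i, S.wordKernel r (S.u w i) {y | (Fin.cons i y : Fin (r + 1) → X) ∈ A} ∂S.P w := by
  have := S.isMarkovKernel_P
  rw [wordKernel, Kernel.map_apply' _ (measurable_fin_cons r) _ hA,
    Kernel.compProd_apply (measurable_fin_cons r hA)]
  rfl

/-- Conditioning on the first letter. The complex form lets word probabilities enter estimates made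
for complex-valued functions. -/
theorem ofReal_wordKernel_succ (S : RSCC W X) (r : ℕ) (w : W) {A : Set (Fin (r + 1) → X)}
    (hA : MeasurableSet A) :
    (((S.wordKernel (r + 1) w).real A : ℝ) : ℂ) =
      ∫ i, (((S.wordKernel r (S.u w i)).real
        {y | (Fin.cons i y : Fin (r + 1) → X) ∈ A} : ℝ) : ℂ) ∂S.P w := by
  have := S.isMarkovKernel_P
  rw [integral_complex_ofReal]
  congr 1
  simp only [measureReal_def]
  rw [wordKernel_succ_apply S r w hA, integral_toReal]
  · have := Kernel.measurable_kernel_prodMk_left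
      (κ := (S.wordKernel r).comap (Function.uncurry S.u) S.measurable_u)
      (measurable_fin_cons r |>.comp ((measurable_snd.comp measurable_fst).prodMk measurable_snd) hA)
    exact (this.comp measurable_prodMk_left).aemeasurable
  · exact .of_forall fun i => measure_lt_top _ _

theorem Q_apply (S : RSCC W X) (w : W) : S.Q w = (S.P w).map (S.u w) := by
  have := S.isMarkovKernel_P
  rw [Q, Kernel.map_apply _ S.measurable_u, Kernel.prod_apply, Kernel.id_apply,
    Measure.dirac_prod, Measure.map_map S.measurable_u measurable_prodMk_left]
  rfl

instance (S : RSCC W X) : IsMarkovKernel S.Q := by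
  have := S.isMarkovKernel_P
  exact Kernel.IsMarkovKernel.map _ S.measurable_u

theorem integral_Q (S : RSCC W X) {f : W → ℂ} (hf : Measurable f) (w : W) :
    ∫ z, f z ∂S.Q w = S.U f w := by
  rw [Q_apply]
  exact integral_map (S.measurable_u.comp measurable_prodMk_left).aemeasurable
    hf.aestronglyMeasurable

instance isMarkovKernel_Q_pow (S : RSCC W X) (n : ℕ) : IsMarkovKernel (S.Q ^ n) := by
  induction n with
  | zero => exact inferInstanceAs (IsMarkovKernel (Kernel.id : Kernel W W))
  | succ n ih =>
    rw [pow_succ]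
    exact inferInstanceAs (IsMarkovKernel ((S.Q ^ n) ∘ₖ S.Q))

/-- The law of the letters after the first `m` ones is `U^[m]` applied to the word kernel. -/
theorem ofReal_wordKernel_preimage (S : RSCC W X) {r : ℕ} {A : Set (Fin r → X)}
    (hA : MeasurableSet A) (m k : ℕ) (h : m + r = k) (w : W) :
    (((S.wordKernel k w).real
      ((fun x i => x (Fin.cast h (Fin.natAdd m i))) ⁻¹' A) : ℝ) : ℂ) =
      S.U^[m] (fun z => (((S.wordKernel r z).real A : ℝ) : ℂ)) w := by
  induction m generalizing k w with
  | zero =>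
    obtain rfl : r = k := by omega
    have : (fun (x : Fin r → X) i => x (Fin.cast h (Fin.natAdd 0 i))) = id := by
      ext x i; simp only [id]; congr 1; ext; simp
    rw [this]
    rfl
  | succ m ih =>
    -- The length k is tied to m + 1 + r only by an equation, so it can be rewritten as a successor
    -- and the first letter peeled off.
    obtain ⟨k, rfl⟩ : ∃ j, k = j + 1 := ⟨m + r, by omega⟩
    have hm : Measurable
        (fun (x : Fin (k + 1) → X) (i : Fin r) => x (Fin.cast h (Fin.natAdd (m + 1) i))) :=
      measurable_pi_lambda _ fun i => measurable_pi_apply _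
    rw [ofReal_wordKernel_succ S k w (hm hA), Function.iterate_succ_apply', U]
    congr 1
    ext i
    rw [← ih k (by omega)]
    congr 3
    ext y
    simp only [Set.mem_preimage]
    have : (fun j : Fin r => (Fin.cons i y : Fin (k + 1) → X) (Fin.cast h (Fin.natAdd (m + 1) j))) =
        fun j => y (Fin.cast (by omega) (Fin.natAdd m j)) := by
      ext j
      have : Fin.cast h (Fin.natAdd (m + 1) j) =
          Fin.succ (Fin.cast (by omega : m + r = k) (Fin.natAdd m j)) := by
        ext; simp; omega
      rw [this, Fin.cons_succ]
    rw [this]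

theorem ofReal_shiftedKernel (S : RSCC W X) (n r : ℕ) {A : Set (Fin r → X)}
    (hA : MeasurableSet A) (w : W) :
    (((S.shiftedKernel n r w).real A : ℝ) : ℂ) =
      S.U^[n - 1] (fun z => (((S.wordKernel r z).real A : ℝ) : ℂ)) w := by
  have hm : Measurable (fun (x : Fin (n - 1 + r) → X) (i : Fin r) => x (Fin.natAdd (n - 1) i)) :=
    measurable_pi_lambda _ fun i => measurable_pi_apply _
  rw [← ofReal_wordKernel_preimage S hA (n - 1) _ rfl, shiftedKernel, Kernel.map_apply _ hm,
    map_measureReal_apply hm hA]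
  rfl

end RSCC

/-- The constant 2 reproduces itself: with L = 2, M = 1 and t = 1/N ≤ 1/2 the recursion yields 1 + t
+ t² ≤ 7/4. Its independence of r and A gives the uniformity in the ergodic theorem. -/
theorem norm_wordKernel_sub_le {N : ℕ} (hN : 2 ≤ N) (r : ℕ) {A : Set (Fin r → Set.Ici N)}
    (x y : Set.Icc (0 : ℝ) 1) :
    ‖((((renyiRSCC N hN).wordKernel r x).real A : ℝ) : ℂ) -
      ((((renyiRSCC N hN).wordKernel r y).real A : ℝ) : ℂ)‖ ≤ 2 * dist x y := by
  induction r generalizing x y with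
  | zero => simp [RSCC.wordKernel]
  | succ r ih =>
    rw [RSCC.ofReal_wordKernel_succ _ _ _ .of_discrete,
      RSCC.ofReal_wordKernel_succ _ _ _ .of_discrete]
    refine (norm_integral_sub_integral_le hN (c := 0) (L := 2) (M := 1)
      (g := fun i z => ((((renyiRSCC N hN).wordKernel r z).real
        {y | (Fin.cons i y : Fin (r + 1) → Set.Ici N) ∈ A} : ℝ) : ℂ))
      (by norm_num) (fun i => ih) (fun i z => ?_) x y).trans ?_
    · rw [sub_zero, Complex.norm_real, Real.norm_of_nonneg measureReal_nonneg]
      exact measureReal_le_one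
    · refine mul_le_mul_of_nonneg_right ?_ dist_nonneg
      have h1 : (2 : ℝ) ≤ N := by exact_mod_cast hN
      have h2 : 1 / (N : ℝ) ≤ 1 / 2 := by gcongr
      have h3 : 0 ≤ 1 / (N : ℝ) := by positivity
      have h4 : 1 / (N : ℝ) ^ 2 = (1 / N) ^ 2 := by ring
      have h5 : 2 / (N : ℝ) = 2 * (1 / N) := by ring
      rw [h4, h5]
      nlinarith

/-! ### The stationary measure and convergence to it. -/

theorem measure_eq_of_forall_lipschitz {μ ν : Measure (Set.Icc (0 : ℝ) 1)}
    [IsProbabilityMeasure μ] [IsProbabilityMeasure ν]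
    (h : ∀ (f : Set.Icc (0 : ℝ) 1 → ℂ) (L : ℝ), 0 ≤ L → (∀ x y, ‖f x - f y‖ ≤ L * dist x y) →
      ∫ x, f x ∂μ = ∫ x, f x ∂ν) : μ = ν := by
  let μ' : ProbabilityMeasure (Set.Icc (0 : ℝ) 1) := ⟨μ, ‹_›⟩
  let ν' : ProbabilityMeasure (Set.Icc (0 : ℝ) 1) := ⟨ν, ‹_›⟩
  -- Lipschitz tests characterise weak convergence, so the constant sequence μ converges to ν; weak
  -- limits are unique.
  have : Tendsto (fun _ : ℕ => μ') atTop (𝓝 ν') := by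
    refine tendsto_iff_forall_lipschitz_integral_tendsto.2 fun f _ ⟨K, hK⟩ => ?_
    have h1 := h (fun x => (f x : ℂ)) K K.2 fun x y => by
      rw [← Complex.ofReal_sub, Complex.norm_real, ← dist_eq_norm]
      exact hK.dist_le_mul x y
    rw [integral_complex_ofReal, integral_complex_ofReal] at h1
    have h2 : ∫ x, f x ∂μ = ∫ x, f x ∂ν := by exact_mod_cast h1
    change Tendsto (fun _ : ℕ => ∫ x, f x ∂μ) atTop (𝓝 (∫ x, f x ∂ν))
    rw [h2]
    exact tendsto_const_nhds
  have h2 : μ' = ν' := tendsto_nhds_unique tendsto_const_nhds this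
  exact congrArg (fun ρ : ProbabilityMeasure (Set.Icc (0 : ℝ) 1) =>
    (ρ : Measure (Set.Icc (0 : ℝ) 1))) h2

theorem integral_bind_Q {N : ℕ} (hN : 2 ≤ N) {μ : Measure (Set.Icc (0 : ℝ) 1)}
    [IsProbabilityMeasure μ] {f : Set.Icc (0 : ℝ) 1 → ℂ} {L : ℝ} (hL : 0 ≤ L)
    (hf : ∀ x y, ‖f x - f y‖ ≤ L * dist x y) :
    ∫ x, f x ∂(μ.bind (renyiRSCC N hN).Q) = ∫ x, (renyiRSCC N hN).U f x ∂μ := by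
  have hm := continuous_of_norm_sub_le hL hf
  have : μ.bind (renyiRSCC N hN).Q = ((renyiRSCC N hN).Q ∘ₖ Kernel.const Unit μ) () := by
    rw [Kernel.comp_apply, Kernel.const_apply]
  rw [this, Kernel.integral_comp (integrable_of_norm_sub_le hm.aestronglyMeasurable
    (norm_sub_half_le hL hf)), Kernel.const_apply]
  simp only [RSCC.integral_Q _ hm.measurable]

theorem invariant_iff_forall_lipschitz {N : ℕ} (hN : 2 ≤ N) {μ : Measure (Set.Icc (0 : ℝ) 1)}
    [IsProbabilityMeasure μ] : Kernel.Invariant (renyiRSCC N hN).Q μ ↔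
      ∀ (f : Set.Icc (0 : ℝ) 1 → ℂ) (L : ℝ), 0 ≤ L → (∀ x y, ‖f x - f y‖ ≤ L * dist x y) →
        ∫ x, (renyiRSCC N hN).U f x ∂μ = ∫ x, f x ∂μ := by
  refine ⟨fun h f L hL hf => ?_, fun h => ?_⟩
  · rw [← integral_bind_Q hN hL hf, h.def]
  · refine measure_eq_of_forall_lipschitz fun f L hL hf => ?_
    rw [integral_bind_Q hN hL hf, h f L hL hf]

theorem integral_U_iterate {N : ℕ} (hN : 2 ≤ N) {μ : Measure (Set.Icc (0 : ℝ) 1)}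
    [IsProbabilityMeasure μ] (hμ : Kernel.Invariant (renyiRSCC N hN).Q μ)
    {f : Set.Icc (0 : ℝ) 1 → ℂ} {L : ℝ} (hL : 0 ≤ L)
    (hf : ∀ x y, ‖f x - f y‖ ≤ L * dist x y) (n : ℕ) :
    ∫ x, (renyiRSCC N hN).U^[n] f x ∂μ = ∫ x, f x ∂μ := by
  induction n with
  | zero => rfl
  | succ n ih =>
    rw [Function.iterate_succ', ← ih]
    exact (invariant_iff_forall_lipschitz hN).1 hμ _ _ (by positivity)
      (norm_U_iterate_sub_le hN hL hf n)

/-- By invariance the difference is the μ-average over y of `U^[n] f x - U^[n] f y`, and [0, 1] has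
diameter 1. -/
theorem norm_U_iterate_sub_integral_le {N : ℕ} (hN : 2 ≤ N) {μ : Measure (Set.Icc (0 : ℝ) 1)}
    [IsProbabilityMeasure μ] (hμ : Kernel.Invariant (renyiRSCC N hN).Q μ)
    {f : Set.Icc (0 : ℝ) 1 → ℂ} {L : ℝ} (hL : 0 ≤ L)
    (hf : ∀ x y, ‖f x - f y‖ ≤ L * dist x y) (n : ℕ) (x : Set.Icc (0 : ℝ) 1) :
    ‖(renyiRSCC N hN).U^[n] f x - ∫ y, f y ∂μ‖ ≤ (7 / 8) ^ n * L := by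
  have hn := norm_U_iterate_sub_le hN hL hf n
  have hL' : 0 ≤ (7 / 8) ^ n * L := by positivity
  have hi : Integrable ((renyiRSCC N hN).U^[n] f) μ := integrable_of_norm_sub_le
    (continuous_of_norm_sub_le hL' hn).aestronglyMeasurable (norm_sub_half_le hL' hn)
  have : (renyiRSCC N hN).U^[n] f x - ∫ y, f y ∂μ =
      ∫ y, ((renyiRSCC N hN).U^[n] f x - (renyiRSCC N hN).U^[n] f y) ∂μ := by
    rw [integral_sub (integrable_const _) hi, integral_U_iterate hN hμ hL hf]
    simp
  rw [this]
  refine (norm_integral_le_of_norm_le_const (.of_forall fun y => (hn x y).trans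
    (mul_le_of_le_one_right hL' (dist_Icc_le_one x y)))).trans_eq ?_
  simp

theorem invariant_unique {N : ℕ} (hN : 2 ≤ N) {μ ν : Measure (Set.Icc (0 : ℝ) 1)}
    [IsProbabilityMeasure μ] [IsProbabilityMeasure ν]
    (hμ : Kernel.Invariant (renyiRSCC N hN).Q μ) (hν : Kernel.Invariant (renyiRSCC N hN).Q ν) :
    μ = ν := by
  refine measure_eq_of_forall_lipschitz fun f L hL hf => ?_
  have h0 : Tendsto (fun n : ℕ => (7 / 8 : ℝ) ^ n * L) atTop (𝓝 0) := by
    simpa using (tendsto_pow_atTop_nhds_zero_of_lt_one (by norm_num) (by norm_num)).mul_const L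
  have key : ∀ (ρ : Measure (Set.Icc (0 : ℝ) 1)) [IsProbabilityMeasure ρ],
      Kernel.Invariant (renyiRSCC N hN).Q ρ →
      Tendsto (fun n => (renyiRSCC N hN).U^[n] f 0) atTop (𝓝 (∫ y, f y ∂ρ)) := fun ρ _ hρ =>
    tendsto_iff_norm_sub_tendsto_zero.2 <| squeeze_zero (fun _ => norm_nonneg _)
      (fun n => norm_U_iterate_sub_integral_le hN hρ hL hf n 0) h0
  exact tendsto_nhds_unique (key μ hμ) (key ν hν)

theorem integral_Q_pow {N : ℕ} (hN : 2 ≤ N) {f : Set.Icc (0 : ℝ) 1 → ℂ} {L : ℝ} (hL : 0 ≤ L)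
    (hf : ∀ x y, ‖f x - f y‖ ≤ L * dist x y) (n : ℕ) (w : Set.Icc (0 : ℝ) 1) :
    ∫ x, f x ∂((renyiRSCC N hN).Q ^ n) w = (renyiRSCC N hN).U^[n] f w := by
  induction n generalizing f L with
  | zero =>
    change ∫ x, f x ∂Kernel.id w = f w
    rw [Kernel.id_apply, integral_dirac]
  | succ n ih =>
    rw [Function.iterate_succ_apply, ← ih (by positivity) (norm_U_sub_le hN hL hf),
      ← integral_bind_Q hN hL hf, ← Kernel.comp_apply, pow_succ']
    rfl

/-- A weak limit point of Q^n(0, ·) is invariant without Cesàro averaging, because the oscillation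
of `U^[n] f` tends to 0. -/
theorem exists_invariant {N : ℕ} (hN : 2 ≤ N) : ∃ μ : Measure (Set.Icc (0 : ℝ) 1),
    IsProbabilityMeasure μ ∧ Kernel.Invariant (renyiRSCC N hN).Q μ := by
  let ν : ℕ → ProbabilityMeasure (Set.Icc (0 : ℝ) 1) :=
    fun n => ⟨((renyiRSCC N hN).Q ^ n) 0, inferInstance⟩
  obtain ⟨μ, -, φ, hφ, hμ⟩ := isCompact_univ.tendsto_subseq (x := ν) (fun n => Set.mem_univ _)
  refine ⟨μ, inferInstance, (invariant_iff_forall_lipschitz hN).2 fun f L hL hf => ?_⟩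
  have key : ∀ (g : Set.Icc (0 : ℝ) 1 → ℂ) (K : ℝ), 0 ≤ K →
      (∀ x y, ‖g x - g y‖ ≤ K * dist x y) →
      Tendsto (fun n => (renyiRSCC N hN).U^[φ n] g 0) atTop (𝓝 (∫ x, g x ∂(μ : Measure _))) := by
    intro g K hK hg
    have hgi : ∀ ρ : ProbabilityMeasure (Set.Icc (0 : ℝ) 1), Integrable g ρ := fun ρ =>
      integrable_of_norm_sub_le (continuous_of_norm_sub_le hK hg).aestronglyMeasurable
        (norm_sub_half_le hK hg)
    -- Weak convergence is tested on real functions; T is later the real and the imaginary part.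
    have part : ∀ T : ℂ →L[ℝ] ℝ, Tendsto (fun n => T ((renyiRSCC N hN).U^[φ n] g 0)) atTop
        (𝓝 (T (∫ x, g x ∂(μ : Measure _)))) := by
      intro T
      have hc : Continuous fun x => T (g x) := T.continuous.comp (continuous_of_norm_sub_le hK hg)
      have := (ProbabilityMeasure.tendsto_iff_forall_integral_tendsto.1 hμ)
        (BoundedContinuousFunction.mkOfCompact ⟨_, hc⟩)
      simp only [BoundedContinuousFunction.mkOfCompact_apply, ContinuousMap.coe_mk,
        T.integral_comp_comm (hgi _)] at this
      exact this.congr fun n => congrArg T (integral_Q_pow hN hK hg (φ n) 0)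
    have h := ((Complex.continuous_ofReal.tendsto _).comp (part Complex.reCLM)).add
      (((Complex.continuous_ofReal.tendsto _).comp (part Complex.imCLM)).mul_const Complex.I)
    simpa only [Function.comp_def, Complex.reCLM_apply, Complex.imCLM_apply,
      Complex.re_add_im] using h
  refine tendsto_nhds_unique (key _ _ (by positivity) (norm_U_sub_le hN hL hf)) ?_
  have h1 := key f L hL hf
  have h0 : Tendsto (fun n => (renyiRSCC N hN).U^[φ n] ((renyiRSCC N hN).U f) 0 -
      (renyiRSCC N hN).U^[φ n] f 0) atTop (𝓝 0) := by
    have hz : Tendsto (fun n : ℕ => (7 / 8 : ℝ) ^ φ n * L) atTop (𝓝 0) := by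
      simpa using ((tendsto_pow_atTop_nhds_zero_of_lt_one (by norm_num) (by norm_num)).comp
        hφ.tendsto_atTop).mul_const L
    refine squeeze_zero_norm (fun n => ?_) hz
    have hn := norm_U_iterate_sub_le hN hL hf (φ n)
    have hL' : 0 ≤ (7 / 8) ^ φ n * L := by positivity
    set h := (renyiRSCC N hN).U^[φ n] f with hh
    rw [← Function.iterate_succ_apply, Function.iterate_succ_apply', ← hh]
    have hb : ∀ z, ‖h z - h 0‖ ≤ (7 / 8) ^ φ n * L := fun z =>
      (hn z 0).trans (mul_le_of_le_one_right hL' (dist_Icc_le_one z 0))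
    -- One more application of `U` averages values of h, each within the oscillation of h from h 0.
    have e : (renyiRSCC N hN).U h 0 - h 0 =
        ∫ i, (h ((renyiRSCC N hN).u 0 i) - h 0) ∂(renyiRSCC N hN).P 0 := by
      rw [integral_sub (integrable_of_norm_sub_le
        (measurable_of_countable _).aestronglyMeasurable fun i => hb _) (integrable_const _)]
      simp [RSCC.U]
    rw [e]
    refine (norm_integral_le_of_norm_le_const (.of_forall fun i => hb _)).trans_eq ?_
    simp
  simpa using h0.add h1

/-! ### The Lipschitz norm, regularity, contraction and uniform ergodicity. -/

theorem lipNorm_le_ofReal {W : Type*} [MetricSpace W] {f : W → ℂ} {M L : ℝ} (hM : 0 ≤ M)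
    (hL : 0 ≤ L) (hfM : ∀ x, ‖f x‖ ≤ M) (hf : ∀ x y, ‖f x - f y‖ ≤ L * dist x y) :
    lipNorm f ≤ ENNReal.ofReal (M + L) := by
  rw [ENNReal.ofReal_add hM hL, lipNorm]
  refine add_le_add (iSup_le fun x => ?_)
    (iSup_le fun x => iSup_le fun y => iSup_le fun _ => ENNReal.div_le_of_le_mul ?_)
  · rw [← ofReal_norm]
    exact ENNReal.ofReal_le_ofReal (hfM x)
  · rw [← ofReal_norm, edist_dist, ← ENNReal.ofReal_mul hL]
    exact ENNReal.ofReal_le_ofReal (hf x y)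

/-- M and L are the supremum and the Lipschitz seminorm themselves, hence the equality; norm
estimates become real arithmetic. -/
theorem exists_of_mem_lipSpace {W : Type*} [MetricSpace W] {f : W → ℂ} (hf : f ∈ lipSpace W) :
    ∃ M L : ℝ, 0 ≤ M ∧ 0 ≤ L ∧ (∀ x, ‖f x‖ ≤ M) ∧ (∀ x y, ‖f x - f y‖ ≤ L * dist x y) ∧
      lipNorm f = ENNReal.ofReal (M + L) := by
  have hf' : lipNorm f < ∞ := hf
  obtain ⟨h1, h2⟩ := ENNReal.add_lt_top.1 hf'
  refine ⟨_, _, ENNReal.toReal_nonneg (a := ⨆ w : W, ‖f w‖ₑ), ENNReal.toReal_nonneg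
    (a := ⨆ (x : W) (y : W) (_ : x ≠ y), ‖f x - f y‖ₑ / edist x y), fun x => ?_, fun x y => ?_, ?_⟩
  · rw [← toReal_enorm]
    exact ENNReal.toReal_mono h1.ne (le_iSup (fun w => ‖f w‖ₑ) x)
  · rcases eq_or_ne x y with rfl | hxy
    · simp
    have : ‖f x - f y‖ₑ / edist x y ≤ ⨆ (x : W) (y : W) (_ : x ≠ y), ‖f x - f y‖ₑ / edist x y :=
      le_iSup₂_of_le x y (le_iSup (fun _ : x ≠ y => ‖f x - f y‖ₑ / edist x y) hxy)
    rw [← toReal_enorm, dist_edist, ← ENNReal.toReal_mul]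
    refine ENNReal.toReal_mono (ENNReal.mul_ne_top h2.ne (edist_ne_top _ _)) ?_
    exact (ENNReal.div_le_iff (edist_pos.2 hxy).ne' (edist_ne_top _ _)).1 this
  · rw [ENNReal.ofReal_add ENNReal.toReal_nonneg ENNReal.toReal_nonneg,
      ENNReal.ofReal_toReal h1.ne, ENNReal.ofReal_toReal h2.ne, lipNorm]

theorem integrable_of_mem_lipSpace {f : Set.Icc (0 : ℝ) 1 → ℂ} (hf : f ∈ lipSpace _)
    (μ : Measure (Set.Icc (0 : ℝ) 1)) [IsFiniteMeasure μ] : Integrable f μ := by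
  obtain ⟨M, L, -, hL, -, hfL, -⟩ := exists_of_mem_lipSpace hf
  exact integrable_of_norm_sub_le (continuous_of_norm_sub_le hL hfL).aestronglyMeasurable
    (norm_sub_half_le hL hfL)

/-- The sup norm and the seminorm of the difference are each at most (7/8)^n L, whence the factor 2.
-/
theorem lipNorm_U_iterate_sub_le {N : ℕ} (hN : 2 ≤ N) {μ : Measure (Set.Icc (0 : ℝ) 1)}
    [IsProbabilityMeasure μ] (hμ : Kernel.Invariant (renyiRSCC N hN).Q μ)
    {f : Set.Icc (0 : ℝ) 1 → ℂ} (hf : f ∈ lipSpace _) (n : ℕ) :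
    lipNorm ((renyiRSCC N hN).U^[n] f - Function.const _ (∫ y, f y ∂μ)) ≤
      ENNReal.ofReal (2 * (7 / 8) ^ n) * lipNorm f := by
  obtain ⟨M, L, hM, hL, hfM, hfL, e⟩ := exists_of_mem_lipSpace hf
  rw [e, ← ENNReal.ofReal_mul (by positivity)]
  have hp : 0 ≤ (7 / 8 : ℝ) ^ n := by positivity
  refine (lipNorm_le_ofReal (by positivity) (by positivity)
    (norm_U_iterate_sub_integral_le hN hμ hL hfL n) fun x y => ?_).trans
    (ENNReal.ofReal_le_ofReal (?_ : (7 / 8) ^ n * L + (7 / 8) ^ n * L ≤ _))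
  · simpa using norm_U_iterate_sub_le hN hL hfL n x y
  · nlinarith [mul_nonneg hp hM]

theorem lipNorm_U_le {N : ℕ} (hN : 2 ≤ N) {f : Set.Icc (0 : ℝ) 1 → ℂ} (hf : f ∈ lipSpace _) :
    lipNorm ((renyiRSCC N hN).U f) ≤ lipNorm f := by
  obtain ⟨M, L, hM, hL, hfM, hfL, e⟩ := exists_of_mem_lipSpace hf
  rw [e]
  exact (lipNorm_le_ofReal hM (by positivity) (norm_U_le hN hfM) (norm_U_sub_le hN hL hfL)).trans
    (ENNReal.ofReal_le_ofReal (by linarith))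

theorem lipNorm_const_le {W : Type*} [MetricSpace W] (c : ℂ) :
    lipNorm (Function.const W c) ≤ ‖c‖ₑ := by
  rw [← ofReal_norm]
  simpa using lipNorm_le_ofReal (f := Function.const W c) (L := 0) (norm_nonneg c) le_rfl
    (fun _ => le_rfl) (by simp)

/-- The operator `f ↦ ∫ f dμ` with values in the constant functions of `lipSpace`. -/
noncomputable def lipIntegral (μ : Measure (Set.Icc (0 : ℝ) 1)) [IsProbabilityMeasure μ] :
    lipSpace (Set.Icc (0 : ℝ) 1) →ₗ[ℂ] lipSpace (Set.Icc (0 : ℝ) 1) where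
  toFun f := ⟨Function.const _ (∫ y, (f : Set.Icc (0 : ℝ) 1 → ℂ) y ∂μ),
    (lipNorm_const_le _).trans_lt enorm_lt_top⟩
  map_add' f g := by
    ext x
    exact integral_add (integrable_of_mem_lipSpace f.2 μ) (integrable_of_mem_lipSpace g.2 μ)
  map_smul' c f := by
    ext x
    exact integral_const_mul c _

theorem finrank_range_lipIntegral (μ : Measure (Set.Icc (0 : ℝ) 1)) [IsProbabilityMeasure μ] :
    Module.finrank ℂ (LinearMap.range (lipIntegral μ)) = 1 := by
  let e : lipSpace (Set.Icc (0 : ℝ) 1) :=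
    ⟨Function.const _ 1, (lipNorm_const_le _).trans_lt enorm_lt_top⟩
  have he : lipIntegral μ e = e := by
    ext x
    change ∫ _, (1 : ℂ) ∂μ = 1
    simp
  have hr : LinearMap.range (lipIntegral μ) = Submodule.span ℂ {e} := by
    refine le_antisymm ?_ ((Submodule.span_singleton_le_iff_mem _ _).2 ⟨e, he⟩)
    rintro _ ⟨f, rfl⟩
    refine Submodule.mem_span_singleton.2
      ⟨∫ y, (f : Set.Icc (0 : ℝ) 1 → ℂ) y ∂μ, Subtype.ext ?_⟩
    ext x
    exact mul_one _
  rw [hr]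
  refine finrank_span_singleton fun h => ?_
  have := congrFun (congrArg (fun z => (z.1 : Set.Icc (0 : ℝ) 1 → ℂ)) h) 0
  exact one_ne_zero (α := ℂ) this

theorem isRegular_renyiRSCC {N : ℕ} (hN : 2 ≤ N) : (renyiRSCC N hN).IsRegular := by
  obtain ⟨μ, _, hμ⟩ := exists_invariant hN
  refine ⟨⟨1, fun f hf => by simpa using lipNorm_U_le hN hf⟩, lipIntegral μ, ⟨1, fun f => ?_⟩,
    finrank_range_lipIntegral μ, ?_⟩
  · obtain ⟨M, L, hM, hL, hfM, -, e⟩ := exists_of_mem_lipSpace f.2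
    rw [e, ENNReal.coe_one, one_mul]
    refine (lipNorm_const_le _).trans ?_
    rw [← ofReal_norm]
    refine ENNReal.ofReal_le_ofReal ?_
    have := norm_integral_le_of_norm_le_const (μ := μ) (.of_forall hfM)
    simp only [probReal_univ, mul_one] at this
    linarith
  · have h0 : Tendsto (fun n : ℕ => ENNReal.ofReal (2 * (7 / 8) ^ n)) atTop (𝓝 0) := by
      have := (tendsto_pow_atTop_nhds_zero_of_lt_one (r := (7 / 8 : ℝ)) (by norm_num)
        (by norm_num)).const_mul 2
      simpa using ENNReal.tendsto_ofReal this
    refine tendsto_of_tendsto_of_tendsto_of_le_of_le tendsto_const_nhds h0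
      (fun _ => zero_le) fun n => iSup₂_le fun f hf => ?_
    refine (lipNorm_U_iterate_sub_le hN hμ f.2 n).trans ?_
    calc _ ≤ ENNReal.ofReal (2 * (7 / 8) ^ n) * 1 := by gcongr
      _ = _ := mul_one _

theorem isWithContraction_renyiRSCC {N : ℕ} (hN : 2 ≤ N) :
    (renyiRSCC N hN).IsWithContraction := by
  have h1 : (2 : ℝ) ≤ N := by exact_mod_cast hN
  have hr : (renyiRSCC N hN).rCoeff 1 ≤ ENNReal.ofReal (1 / 2) := by
    refine iSup_le fun x => iSup_le fun y => iSup_le fun _ => ENNReal.div_le_of_le_mul ?_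
    refine (lintegral_mono (g := fun _ => ENNReal.ofReal (1 / 2) * edist x y)
      fun w => ?_).trans_eq (by simp)
    rw [edist_dist, edist_dist, ← ENNReal.ofReal_mul (by norm_num)]
    refine ENNReal.ofReal_le_ofReal ?_
    change dist ((renyiRSCC N hN).u x (w 0)) ((renyiRSCC N hN).u y (w 0)) ≤ _
    rw [Subtype.dist_eq, Subtype.dist_eq, Real.dist_eq, Real.dist_eq]
    refine (abs_renyiU_sub_le hN (w 0).2 x.2.1 y.2.1).trans ?_
    rw [div_mul_eq_mul_div, one_mul]
    gcongr
  have hlt : ENNReal.ofReal (1 / 2) < 1 := by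
    rw [ENNReal.ofReal_lt_one]; norm_num
  -- Every branch contracts by 1/N ≤ 1/2, so j = 1 already suffices.
  refine ⟨hr.trans_lt (hlt.trans ENNReal.one_lt_top), ?_, 1, le_rfl, hr.trans_lt hlt⟩
  refine lt_of_le_of_lt (b := ENNReal.ofReal 2) ?_ ENNReal.ofReal_lt_top
  refine iSup_le fun A => iSup_le fun _ => iSup_le fun x => iSup_le fun y => iSup_le fun _ =>
    ENNReal.div_le_of_le_mul ?_
  rw [edist_dist, ← ENNReal.ofReal_mul (by norm_num)]
  refine ENNReal.ofReal_le_ofReal ?_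
  have := norm_wordKernel_sub_le hN 1 (A := A) x y
  rwa [← Complex.ofReal_sub, Complex.norm_real, Real.norm_eq_abs] at this

theorem isUniformlyErgodic_renyiRSCC {N : ℕ} (hN : 2 ≤ N) :
    (renyiRSCC N hN).IsUniformlyErgodic := by
  obtain ⟨μ, _, hμ⟩ := exists_invariant hN
  -- The limit is the law of r letters when the initial state is stationary.
  refine ⟨fun r => μ.bind ((renyiRSCC N hN).wordKernel r), fun r _ => inferInstance,
    fun ε hε => ?_⟩
  obtain ⟨m, hm⟩ := exists_pow_lt_of_lt_one (half_pos hε) (by norm_num : (7 / 8 : ℝ) < 1)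
  -- The error is at most 2 (7/8)^(n-1), since only n - 1 letters precede the observed block.
  refine ⟨m + 1, fun n hn w r _ A hA => ?_⟩
  have hl := norm_wordKernel_sub_le hN r (A := A)
  have e : (((μ.bind ((renyiRSCC N hN).wordKernel r)).real A : ℝ) : ℂ) =
      ∫ z, ((((renyiRSCC N hN).wordKernel r z).real A : ℝ) : ℂ) ∂μ := by
    rw [integral_complex_ofReal]
    congr 1
    simp only [measureReal_def]
    rw [Measure.bind_apply hA (Kernel.aemeasurable _), integral_toReal
      (Kernel.measurable_coe _ hA).aemeasurable (.of_forall fun _ => measure_lt_top _ _)]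
  have h := norm_U_iterate_sub_integral_le hN hμ (by norm_num) hl (n - 1) w
  rw [← RSCC.ofReal_shiftedKernel _ _ _ hA, ← e, ← Complex.ofReal_sub, Complex.norm_real,
    Real.norm_eq_abs] at h
  have : (7 / 8 : ℝ) ^ (n - 1) ≤ (7 / 8) ^ m :=
    pow_le_pow_of_le_one (by norm_num) (by norm_num) (by omega)
  linarith

/-! ### Supports of the n-step transition probabilities. -/

/-- The word i i ⋯ i has positive probability, so its endpoint is an atom. -/
theorem pow_Q_singleton_iterate_pos {N : ℕ} (hN : 2 ≤ N) (i : Set.Ici N) (n : ℕ)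
    (x : Set.Icc (0 : ℝ) 1) :
    0 < ((renyiRSCC N hN).Q ^ n) x {(fun y => (renyiRSCC N hN).u y i)^[n] x} := by
  induction n with
  | zero =>
    change 0 < Kernel.id x {x}
    simp [Kernel.id_apply]
  | succ n ih =>
    rw [Kernel.pow_succ_apply_eq_lintegral _ _ _ (measurableSet_singleton _),
      Function.iterate_succ_apply']
    set z := (fun y => (renyiRSCC N hN).u y i)^[n] x
    have hz : 0 < (renyiRSCC N hN).Q z {(renyiRSCC N hN).u z i} := by
      rw [RSCC.Q_apply, Measure.map_apply (measurable_of_countable _) (measurableSet_singleton _),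
        renyiRSCC_P_apply, Measure.sum_apply _ .of_discrete]
      refine lt_of_lt_of_le ?_ (ENNReal.le_tsum i)
      have h1 : (2 : ℝ) ≤ N := by exact_mod_cast hN
      have h2 : (N : ℝ) ≤ (i : ℕ) := by exact_mod_cast i.2
      have h3 := z.2.1
      have : 0 < renyiP N z i := div_pos (by linarith) (mul_pos (by linarith) (by linarith))
      simp [this]
    calc 0 < (renyiRSCC N hN).Q z {(renyiRSCC N hN).u z i} * ((renyiRSCC N hN).Q ^ n) x {z} :=
          ENNReal.mul_pos hz.ne' ih.ne'
      _ = ∫⁻ b in {z}, (renyiRSCC N hN).Q b {(renyiRSCC N hN).u z i}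
            ∂((renyiRSCC N hN).Q ^ n) x := by rw [lintegral_singleton]
      _ ≤ _ := setLIntegral_le_lintegral _ _

theorem exists_fixedPoint_infEDist_tendsto {N : ℕ} (hN : 2 ≤ N) :
    ∃ xstar : Set.Icc (0 : ℝ) 1, (xstar : ℝ) = (√((N : ℝ) ^ 2 + 4) - N) / 2 ∧
      ∀ x : Set.Icc (0 : ℝ) 1,
        Tendsto (fun n : ℕ => Metric.infEDist xstar (((renyiRSCC N hN).Q ^ n) x).support)
          atTop (𝓝 0) := by
  have h1 : (2 : ℝ) ≤ N := by exact_mod_cast hN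
  set s := √((N : ℝ) ^ 2 + 4) with hs
  have hsq : s ^ 2 = (N : ℝ) ^ 2 + 4 := Real.sq_sqrt (by positivity)
  have hs1 : (N : ℝ) ≤ s := Real.le_sqrt_of_sq_le (by linarith)
  have hs2 : s ≤ N + 2 := Real.sqrt_le_iff.2 ⟨by linarith, by nlinarith⟩
  let p : Set.Icc (0 : ℝ) 1 := ⟨(s - N) / 2, by linarith, by linarith⟩
  -- The equation u(x, N + 1) = x reduces to x² + N x - 1 = 0, whose positive root is x*.
  let i : Set.Ici N := ⟨N + 1, Nat.le_succ N⟩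
  refine ⟨p, rfl, fun x => ?_⟩
  let T : Set.Icc (0 : ℝ) 1 → Set.Icc (0 : ℝ) 1 := fun y => (renyiRSCC N hN).u y i
  have hT : ∀ y, dist p (T y) ≤ 1 / 2 * dist p y := by
    intro y
    have hp : T p = p := by
      refine Subtype.ext ?_
      change 1 - (N : ℝ) / ((s - N) / 2 + ((N + 1 : ℕ) : ℝ)) = (s - N) / 2
      push_cast
      have : (s - N) / 2 + ((N : ℝ) + 1) ≠ 0 := by linarith
      rw [sub_eq_iff_eq_add, ← sub_eq_iff_eq_add', eq_div_iff this]
      nlinarith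
    calc dist p (T y) = dist (T p) (T y) := by rw [hp]
      _ ≤ dist p y / N := abs_renyiU_sub_le hN i.2 p.2.1 y.2.1
      _ ≤ dist p y / 2 := by gcongr
      _ = _ := by ring
  have hTn : ∀ n, dist p (T^[n] x) ≤ (1 / 2) ^ n := by
    intro n
    induction n with
    | zero => simpa using dist_Icc_le_one p x
    | succ n ih =>
      rw [Function.iterate_succ_apply', pow_succ']
      exact (hT _).trans (by gcongr)
  have h0 : Tendsto (fun n : ℕ => ENNReal.ofReal ((1 / 2) ^ n)) atTop (𝓝 0) := by
    simpa using ENNReal.tendsto_ofReal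
      (tendsto_pow_atTop_nhds_zero_of_lt_one (r := (1 / 2 : ℝ)) (by norm_num) (by norm_num))
  refine tendsto_of_tendsto_of_tendsto_of_le_of_le tendsto_const_nhds h0
    (fun _ => zero_le) fun n => ?_
  refine (Metric.infEDist_le_edist_of_mem (y := T^[n] x) ?_).trans ?_
  · refine (Measure.mem_support_iff_forall _).2 fun V hV => ?_
    exact (pow_Q_singleton_iterate_pos hN i n x).trans_le
      (measure_mono (Set.singleton_subset_iff.2 (mem_of_mem_nhds hV)))
  · rw [edist_dist]
    exact ENNReal.ofReal_le_ofReal (hTn n)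

theorem proposition6p3 (N : ℕ) (hN : 2 ≤ N) :
    (renyiRSCC N hN).IsWithContraction ∧
    (∃ xstar : Set.Icc (0 : ℝ) 1, (xstar : ℝ) = (√((N : ℝ) ^ 2 + 4) - N) / 2 ∧
      ∀ x : Set.Icc (0 : ℝ) 1,
        Tendsto (fun n : ℕ => Metric.infEDist xstar (((renyiRSCC N hN).Q ^ n) x).support)
          atTop (𝓝 0)) ∧
    (renyiRSCC N hN).IsRegular ∧
    (renyiRSCC N hN).IsUniformlyErgodic ∧
    ∃ Qinf : Measure (Set.Icc (0 : ℝ) 1), IsProbabilityMeasure Qinf ∧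
      Kernel.Invariant (renyiRSCC N hN).Q Qinf ∧
      (∀ μ : Measure (Set.Icc (0 : ℝ) 1), IsProbabilityMeasure μ →
        Kernel.Invariant (renyiRSCC N hN).Q μ → μ = Qinf) ∧
      ∃ k q : ℝ, 0 < k ∧ 0 < q ∧ q < 1 ∧
        ∀ n : ℕ, 1 ≤ n → ∀ f ∈ lipSpace (Set.Icc (0 : ℝ) 1),
          lipNorm ((renyiRSCC N hN).U^[n] f - Function.const _ (∫ y, f y ∂Qinf))
            ≤ ENNReal.ofReal (k * q ^ n) * lipNorm f := by
  obtain ⟨μ, hμ1, hμ⟩ := exists_invariant hN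
  refine ⟨isWithContraction_renyiRSCC hN, exists_fixedPoint_infEDist_tendsto hN,
    isRegular_renyiRSCC hN, isUniformlyErgodic_renyiRSCC hN, μ, hμ1, hμ,
    fun ν _ hν => invariant_unique hN hν hμ, 2, 7 / 8, by norm_num, by norm_num, by norm_num,
    fun n _ f hf => lipNorm_U_iterate_sub_le hN hμ hf n⟩
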